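/- Let $n_1,\dots,n_k\ge 1$ be integers and let $X_i$ be an $n_i$-dimensional real normed space for $i=1,\dots,k$. For real normed spaces $X,Y$ of the same finite dimension, let $d_{BM}(X,Y)=\inf\|T\|\,\|T^{-1}\|$ denote their Banach–Mazur distance, where the infimum is over all invertible linear operators $T:X\to Y$. For $p\in[1,\infty]$, let $X_1\oplus_p\cdots\oplus_p X_k$ be the space $X_1\times\cdots\times X_k$ with the norm $\|(x^1,\dots,x^k)\|=\bigl(\sum_{i=1}^k\|x^i\|_{X_i}^p\bigr)^{1/p}$ (for $p=\infty$: $\max_i\|x^i\|_{X_i}$), let $\|\cdot\|_p$ be the usual $\ell_p$-norm on $\mathbb R^k$, and let $\ell_2^n$ be $\mathbb R^n$ with the Euclidean norm. Then, for every $p\in[1,\infty]$, \[ d_{BM}\bigl(X_1\oplus_p\cdots\oplus_p X_k,\ \ell_2^{\,n_1+\cdots+n_k}\bigr) =\bigl\|\bigl(d_{BM}(X_1,\ell_2^{n_1}),\dots,d_{BM}(X_k,\ell_2^{n_k})\bigr)\bigr\|_r, \] where $r=\frac{2p}{|p-2|}\in[2,\infty]$ (with the conventions $r=\infty$ when $p=2$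 and $r=2$ when $p=\infty$). -/

import Mathlib

open scoped ENNReal

/-- The Banach–Mazur distance `inf ‖T‖ * ‖T⁻¹‖` of two real normed spaces, the infimum running
over all invertible bounded linear operators `T : X → Y` (between finite-dimensional spaces every
linear operator is bounded). It is used only for finite-dimensional spaces of the same dimension,
where such operators exist. -/
noncomputable def banachMazurDist (X Y : Type*)
    [NormedAddCommGroup X] [NormedSpace ℝ X] [NormedAddCommGroup Y] [NormedSpace ℝ Y] : ℝ :=
  ⨅ T : X ≃L[ℝ] Y, ‖(T : X →L[ℝ] Y)‖ * ‖(T.symm : Y →L[ℝ] X)‖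

/-- The exponent `2p / |p - 2|`, understood as `2` for `p = ∞` and as `∞` for `p = 2`. -/
noncomputable def sumExponent (p : ℝ≥0∞) : ℝ≥0∞ :=
  if p = ∞ then 2
  else if p = 2 then ∞
  else ENNReal.ofReal (2 * p.toReal / |p.toReal - 2|)

/-! ### Finite `ℓ_p` norms: monotonicity, Hölder's inequality and its converse. -/

section LpNorm

variable {ι : Type*} [Fintype ι] {p q r s : ℝ≥0∞}

/-! The exponent satisfies `1/r = |1/2 - 1/p|`, so the `r`-norm of a nonnegative weight is the norm
of multiplication by it, from `ℓ_2` to `ℓ_p` if `p ≤ 2` and from `ℓ_p` to `ℓ_2` if `p ≥ 2`. This is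
Hölder's inequality with its converse.

Upper bound (`banachMazurDist_piLp_le`): take near-optimal maps on the summands and glue them
block-diagonally. The distances act as weights on the inverse if `p ≤ 2`, on the map itself if `p ≥
2`. The other direction has norm at most one, since `ℓ_p` norms decrease in `p`.

Lower bound (`norm_toLp_banachMazurDist_le`): choosing signs in a Hilbert space
(`PiLp.norm_le_of_forall_le_norm`) turns any isomorphism into a block-diagonal one with the same
bounds. Testing it on multiples of extremal vectors of the blocks gives a bound for a multiplication
operator, hence for an `r`-norm. -/

theorem PiLp.norm_mono {α β : ι → Type*} [∀ i, NormedAddCommGroup (α i)]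
    [∀ i, NormedAddCommGroup (β i)] (p : ℝ≥0∞) [Fact (1 ≤ p)] {x : PiLp p α} {y : PiLp p β}
    (h : ∀ i, ‖x i‖ ≤ ‖y i‖) : ‖x‖ ≤ ‖y‖ := by
  rcases eq_or_ne p ∞ with rfl | hp
  · rw [PiLp.norm_eq_ciSup, PiLp.norm_eq_ciSup]
    exact ciSup_mono (Set.finite_range _).bddAbove h
  · have h0 : 0 < p.toReal :=
      ENNReal.toReal_pos (zero_lt_one.trans_le (Fact.out : 1 ≤ p)).ne' hp
    rw [PiLp.norm_eq_sum h0, PiLp.norm_eq_sum h0]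
    gcongr with i
    exact h i

theorem PiLp.norm_congr {α β : ι → Type*} [∀ i, NormedAddCommGroup (α i)]
    [∀ i, NormedAddCommGroup (β i)] (p : ℝ≥0∞) [Fact (1 ≤ p)] {x : PiLp p α} {y : PiLp p β}
    (h : ∀ i, ‖x i‖ = ‖y i‖) : ‖x‖ = ‖y‖ :=
  (PiLp.norm_mono p fun i => (h i).le).antisymm (PiLp.norm_mono p fun i => (h i).ge)

theorem PiLp.norm_rpow_eq_sum {α : ι → Type*} [∀ i, NormedAddCommGroup (α i)]
    (h0 : 0 < p.toReal) (x : PiLp p α) :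
    ‖x‖ ^ p.toReal = ∑ i, ‖x i‖ ^ p.toReal := by
  rw [PiLp.norm_eq_sum h0, ← Real.rpow_mul (by positivity), one_div_mul_cancel h0.ne',
    Real.rpow_one]

theorem PiLp.norm_toLp_le_of_le [Fact (1 ≤ p)] [Fact (1 ≤ q)] (h : p ≤ q) (x : ι → ℝ) :
    ‖WithLp.toLp q x‖ ≤ ‖WithLp.toLp p x‖ := by
  have hle : ∀ i, ‖x i‖ ≤ ‖WithLp.toLp p x‖ := fun i => PiLp.norm_apply_le (WithLp.toLp p x) i
  rcases eq_or_ne q ∞ with rfl | hq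
  · rw [PiLp.norm_eq_ciSup]
    exact Real.iSup_le hle (norm_nonneg _)
  have hp : p ≠ ∞ := ne_top_of_le_ne_top hq h
  have hp0 : 0 < p.toReal :=
    ENNReal.toReal_pos (zero_lt_one.trans_le (Fact.out : 1 ≤ p)).ne' hp
  have hpq : p.toReal ≤ q.toReal := (ENNReal.toReal_le_toReal hp hq).2 h
  have hq0 : 0 < q.toReal := hp0.trans_le hpq
  rw [← Real.rpow_le_rpow_iff (norm_nonneg _) (norm_nonneg _) hq0, PiLp.norm_rpow_eq_sum hq0]
  calc ∑ i, ‖x i‖ ^ q.toReal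
      -- Split `q = p + (q - p)` and bound each coordinate by the full norm in the second factor
      -- only.
      ≤ ∑ i, ‖x i‖ ^ p.toReal * ‖WithLp.toLp p x‖ ^ (q.toReal - p.toReal) := by
        gcongr with i
        nth_rw 1 [show q.toReal = p.toReal + (q.toReal - p.toReal) by ring]
        rw [Real.rpow_add_of_nonneg (norm_nonneg _) hp0.le (sub_nonneg.2 hpq)]
        gcongr
        exact hle i
    _ = ‖WithLp.toLp p x‖ ^ q.toReal := by
        rw [← Finset.sum_mul, ← PiLp.norm_rpow_eq_sum hp0 (WithLp.toLp p x),
          ← Real.rpow_add_of_nonneg (norm_nonneg _) hp0.le (sub_nonneg.2 hpq)]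
        ring_nf

theorem PiLp.norm_toLp_mul_const_le [Fact (1 ≤ s)] {f g : ι → ℝ} {c : ℝ} (hg : ∀ i, ‖g i‖ ≤ c) :
    ‖WithLp.toLp s (f * g)‖ ≤ ‖WithLp.toLp s f‖ * c := by
  -- Without an index, `c` may be negative; both norms then vanish.
  rcases isEmpty_or_nonempty ι with h | ⟨⟨i⟩⟩
  · have (f : ι → ℝ) : WithLp.toLp s f = 0 := by ext i; exact h.elim i
    simp [this]
  have hc : 0 ≤ c := (norm_nonneg _).trans (hg i)
  calc ‖WithLp.toLp s (f * g)‖ ≤ ‖c • WithLp.toLp s f‖ := by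
        refine PiLp.norm_mono s fun i => ?_
        simp only [Pi.mul_apply, PiLp.smul_apply, norm_mul, smul_eq_mul,
          Real.norm_of_nonneg hc]
        rw [mul_comm]
        gcongr
        exact hg i
    _ = ‖WithLp.toLp s f‖ * c := by rw [norm_smul, Real.norm_of_nonneg hc, mul_comm]

theorem ENNReal.HolderTriple.toReal_of_ne_top [h : ENNReal.HolderTriple q r s]
    [Fact (1 ≤ q)] [Fact (1 ≤ r)] (hq : q ≠ ∞) (hr : r ≠ ∞) :
    Real.HolderTriple q.toReal r.toReal s.toReal :=
  ENNReal.HolderTriple.toReal _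
    (ENNReal.toReal_pos (zero_lt_one.trans_le (Fact.out : 1 ≤ q)).ne' hq)
    (ENNReal.toReal_pos (zero_lt_one.trans_le (Fact.out : 1 ≤ r)).ne' hr)

/-- Hölder's inequality for the norms of `PiLp`. -/
theorem PiLp.norm_toLp_mul_le (q r : ℝ≥0∞) [Fact (1 ≤ q)] [Fact (1 ≤ r)] [Fact (1 ≤ s)]
    [h : ENNReal.HolderTriple q r s] (f g : ι → ℝ) :
    ‖WithLp.toLp s (f * g)‖ ≤ ‖WithLp.toLp r f‖ * ‖WithLp.toLp q g‖ := by
  have hinv := h.inv_add_inv_eq_inv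
  rcases eq_or_ne q ∞ with rfl | hq
  · obtain rfl : r = s := by simpa using hinv
    exact norm_toLp_mul_const_le fun i => PiLp.norm_apply_le (WithLp.toLp ∞ g) i
  rcases eq_or_ne r ∞ with rfl | hr
  · obtain rfl : q = s := by simpa using hinv
    rw [mul_comm f, mul_comm ‖_‖]
    exact norm_toLp_mul_const_le fun i => PiLp.norm_apply_le (WithLp.toLp ∞ f) i
  have ht : Real.HolderTriple q.toReal r.toReal s.toReal :=
    ENNReal.HolderTriple.toReal_of_ne_top hq hr
  have H := Real.Lr_rpow_le_Lp_mul_Lq_of_nonneg (Finset.univ : Finset ι) ht.symm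
    (f := fun i => ‖f i‖) (g := fun i => ‖g i‖) (fun i _ => norm_nonneg _)
    (fun i _ => norm_nonneg _)
  have hs0 : 0 < s.toReal := ht.pos'
  rw [← Real.rpow_le_rpow_iff (norm_nonneg _) (by positivity) hs0, PiLp.norm_rpow_eq_sum hs0,
    Real.mul_rpow (norm_nonneg _) (norm_nonneg _), PiLp.norm_eq_sum ht.pos,
    PiLp.norm_eq_sum ht.symm.pos, ← Real.rpow_mul (by positivity), ← Real.rpow_mul (by positivity)]
  simpa [norm_mul, div_eq_inv_mul] using H

/-- The converse of Hölder's inequality: the norm of a multiplication operator. -/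
theorem PiLp.norm_toLp_le_of_forall_mul_le (q r : ℝ≥0∞) [Fact (1 ≤ q)] [Fact (1 ≤ r)] [Fact (1 ≤ s)]
    [h : ENNReal.HolderTriple q r s] {f : ι → ℝ} (hf : ∀ i, 0 ≤ f i) {D : ℝ} (hD : 0 ≤ D)
    (H : ∀ g : ι → ℝ, (∀ i, 0 ≤ g i) → ‖WithLp.toLp s (f * g)‖ ≤ D * ‖WithLp.toLp q g‖) :
    ‖WithLp.toLp r f‖ ≤ D := by
  classical
  have hinv := h.inv_add_inv_eq_inv
  rcases eq_or_ne r ∞ with rfl | hr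
  · rw [PiLp.norm_eq_ciSup]
    refine Real.iSup_le (fun i => ?_) hD
    have := H (Pi.single i 1) fun j => by
      by_cases hj : j = i
      · subst hj; simp
      · simp [hj]
    rw [PiLp.toLp_single, PiLp.norm_single, norm_one, mul_one] at this
    refine le_trans ?_ ((PiLp.norm_apply_le _ i).trans this)
    simp
  rcases eq_or_ne q ∞ with rfl | hq
  · obtain rfl : r = s := by simpa using hinv
    have h1 : ‖WithLp.toLp ∞ (1 : ι → ℝ)‖ ≤ 1 := by
      rw [PiLp.norm_eq_ciSup]
      exact Real.iSup_le (fun i => by simp) zero_le_one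
    have := H 1 fun i => zero_le_one
    rw [mul_one] at this
    exact this.trans (mul_le_of_le_one_right hD h1)
  have ht : Real.HolderTriple q.toReal r.toReal s.toReal :=
    ENNReal.HolderTriple.toReal_of_ne_top hq hr
  have hq0 := ht.pos
  have hr0 := ht.symm.pos
  have hs0 := ht.pos'
  set N := ‖WithLp.toLp r f‖ with hN
  rcases (norm_nonneg (WithLp.toLp r f)).eq_or_lt with h0 | h0
  · rw [hN, ← h0]; exact hD
  have hinv' := ht.inv_add_inv_eq_inv
  -- The test function is the equality case of Hölder, `g = f ^ (r/q)`, for which `f * g = f ^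
  -- (r/s)`. The hypothesis becomes `N ^ (1 + r/q) ≤ D * N ^ (r/q)`, and `N > 0` allows cancelling.
  have hexp : r.toReal / s.toReal = 1 + r.toReal / q.toReal := by
    rw [div_eq_mul_inv, ← hinv', mul_add, mul_inv_cancel₀ hr0.ne', div_eq_mul_inv, add_comm]
  have e1 : ‖WithLp.toLp q fun i => f i ^ (r.toReal / q.toReal)‖ = N ^ (r.toReal / q.toReal) := by
    rw [PiLp.norm_eq_sum hq0, hN, PiLp.norm_eq_sum hr0, ← Real.rpow_mul (by positivity)]
    congr 1
    · refine Finset.sum_congr rfl fun i _ => ?_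
      simp only
      rw [Real.norm_of_nonneg (Real.rpow_nonneg (hf i) _), Real.norm_of_nonneg (hf i),
        ← Real.rpow_mul (hf i), div_mul_cancel₀ _ hq0.ne']
    · field_simp
  have e2 : ‖WithLp.toLp s (f * fun i => f i ^ (r.toReal / q.toReal))‖ =
      N ^ (r.toReal / s.toReal) := by
    rw [PiLp.norm_eq_sum hs0, hN, PiLp.norm_eq_sum hr0, ← Real.rpow_mul (by positivity)]
    congr 1
    · refine Finset.sum_congr rfl fun i _ => ?_
      simp only [Pi.mul_apply]
      nth_rw 1 [← Real.rpow_one (f i)]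
      rw [← Real.rpow_add_of_nonneg (hf i) zero_le_one (by positivity), ← hexp,
        Real.norm_of_nonneg (Real.rpow_nonneg (hf i) _), Real.norm_of_nonneg (hf i),
        ← Real.rpow_mul (hf i), div_mul_cancel₀ _ hs0.ne']
    · field_simp
  have := H _ fun i => Real.rpow_nonneg (hf i) (r.toReal / q.toReal)
  rw [e1, e2, hexp, Real.rpow_add h0, Real.rpow_one] at this
  exact le_of_mul_le_mul_right this (Real.rpow_pos_of_pos h0 _)

end LpNorm

/-! ### The exponent `r` as part of a Hölder triple with `2` and `p`. -/

section Exponent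

theorem holderTriple_sumExponent_of_le_two {p : ℝ≥0∞} (h1 : 1 ≤ p) (h2 : p ≤ 2) :
    ENNReal.HolderTriple 2 (sumExponent p) p := by
  have hp : p ≠ ∞ := ne_top_of_le_ne_top (by simp) h2
  rcases eq_or_ne p 2 with rfl | hne
  · exact ⟨by simp [sumExponent]⟩
  rw [sumExponent, if_neg hp, if_neg hne]
  lift p to NNReal using hp
  have h1' : (1 : ℝ) ≤ p := by exact_mod_cast h1
  have h2' : (p : ℝ) < 2 := by exact_mod_cast lt_of_le_of_ne h2 hne
  have h3 : (0 : ℝ) < 2 - p := by linarith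
  have : Real.HolderTriple 2 (2 * p / |(p : ℝ) - 2|) p := by
    rw [abs_of_neg (by linarith)]
    refine ⟨?_, by norm_num, by rw [neg_sub]; positivity⟩
    rw [neg_sub]; field_simp; ring
  simpa using this.ennrealOfReal

theorem holderTriple_sumExponent_of_two_le {p : ℝ≥0∞} (h2 : 2 ≤ p) :
    ENNReal.HolderTriple p (sumExponent p) 2 := by
  rcases eq_or_ne p ∞ with rfl | hp
  · exact ⟨by simp [sumExponent]⟩
  rcases eq_or_ne p 2 with rfl | hne
  · exact ⟨by simp [sumExponent]⟩
  rw [sumExponent, if_neg hp, if_neg hne]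
  lift p to NNReal using hp
  have h2' : (2 : ℝ) < p := by exact_mod_cast lt_of_le_of_ne h2 hne.symm
  have h3 : (0 : ℝ) < p - 2 := by linarith
  have : Real.HolderTriple p (2 * p / |(p : ℝ) - 2|) 2 := by
    rw [abs_of_pos h3]
    refine ⟨?_, by linarith, by positivity⟩
    field_simp; ring
  simpa using this.ennrealOfReal

theorem two_le_sumExponent {p : ℝ≥0∞} (h1 : 1 ≤ p) : 2 ≤ sumExponent p := by
  rw [← ENNReal.inv_le_inv]
  rcases le_total p 2 with h | h
  · have := (holderTriple_sumExponent_of_le_two h1 h).inv_add_inv_eq_inv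
    have h3 : (2 : ℝ≥0∞)⁻¹ + (sumExponent p)⁻¹ ≤ 2⁻¹ + 2⁻¹ := by
      rw [this, ENNReal.inv_two_add_inv_two]
      simpa using h1
    exact (ENNReal.add_le_add_iff_left (by simp)).1 h3
  · rw [← (holderTriple_sumExponent_of_two_le h).inv_add_inv_eq_inv]
    exact le_add_self

end Exponent

/-! ### Banach–Mazur distance to Euclidean space, and extremal vectors. -/

section BanachMazur

theorem banachMazurDist_nonneg (X Y : Type*) [NormedAddCommGroup X] [NormedSpace ℝ X]
    [NormedAddCommGroup Y] [NormedSpace ℝ Y] : 0 ≤ banachMazurDist X Y :=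
  Real.iInf_nonneg fun _ => by positivity

theorem banachMazurDist_le {X Y : Type*} [NormedAddCommGroup X] [NormedSpace ℝ X]
    [NormedAddCommGroup Y] [NormedSpace ℝ Y] (T : X ≃L[ℝ] Y) :
    banachMazurDist X Y ≤ ‖(T : X →L[ℝ] Y)‖ * ‖(T.symm : Y →L[ℝ] X)‖ :=
  ciInf_le ⟨0, by rintro _ ⟨T, rfl⟩; positivity⟩ T

/-- Any linear map into an inner product space which is bounded from above and below bounds the
distance of its domain to a Euclidean space. -/
theorem banachMazurDist_euclidean_le {X H : Type*} [NormedAddCommGroup X] [NormedSpace ℝ X]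
    [FiniteDimensional ℝ X] [NormedAddCommGroup H] [InnerProductSpace ℝ H] {n : ℕ}
    (hn : Module.finrank ℝ X = n) (L : X →ₗ[ℝ] H) {A B : ℝ} (hA : 0 ≤ A) (hB : 0 ≤ B)
    (h₁ : ∀ x, ‖L x‖ ≤ A * ‖x‖) (h₂ : ∀ x, ‖x‖ ≤ B * ‖L x‖) :
    banachMazurDist X (EuclideanSpace ℝ (Fin n)) ≤ A * B := by
  have hinj : Function.Injective L := by
    refine (injective_iff_map_eq_zero L).2 fun x hx => ?_
    have := h₂ x
    rw [hx, norm_zero, mul_zero] at this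
    exact norm_le_zero_iff.1 this
  let e : X ≃ₗ[ℝ] L.range := LinearEquiv.ofInjective L hinj
  have hr : Module.finrank ℝ L.range = n := by rw [← e.finrank_eq, hn]
  -- The range is an `n`-dimensional inner product space, so orthonormal coordinates identify it
  -- isometrically with Euclidean space, whatever the dimension of `H`.
  let b := (stdOrthonormalBasis ℝ L.range).reindex (finCongr hr)
  let T : X ≃L[ℝ] EuclideanSpace ℝ (Fin n) :=
    (e.trans b.repr.toLinearEquiv).toContinuousLinearEquiv
  have hT : ∀ x, ‖T x‖ = ‖L x‖ := fun x => b.repr.norm_map (e x)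
  refine (banachMazurDist_le T).trans ?_
  gcongr
  · exact ContinuousLinearMap.opNorm_le_bound _ hA fun x => (hT x).trans_le (h₁ x)
  · refine ContinuousLinearMap.opNorm_le_bound _ hB fun y => ?_
    have := h₂ (T.symm y)
    rwa [← hT, T.apply_symm_apply] at this

/-- A near-optimal isomorphism divided by its norm: the whole distortion is moved to the inverse. -/
theorem exists_linearMap_of_banachMazurDist_lt {X Y : Type*} [NormedAddCommGroup X]
    [NormedSpace ℝ X] [NormedAddCommGroup Y] [NormedSpace ℝ Y] [FiniteDimensional ℝ X]
    [FiniteDimensional ℝ Y] (h : Module.finrank ℝ X = Module.finrank ℝ Y) {δ : ℝ}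
    (hδ : banachMazurDist X Y < δ) :
    ∃ L : X →ₗ[ℝ] Y, ∀ x, ‖L x‖ ≤ ‖x‖ ∧ ‖x‖ ≤ δ * ‖L x‖ := by
  have : Nonempty (X ≃L[ℝ] Y) := FiniteDimensional.nonempty_continuousLinearEquiv_of_finrank_eq h
  obtain ⟨T, hT⟩ := exists_lt_of_ciInf_lt hδ
  have hupper : ∀ x, ‖T x‖ ≤ ‖(T : X →L[ℝ] Y)‖ * ‖x‖ := (T : X →L[ℝ] Y).le_opNorm
  have hlower : ∀ x, ‖x‖ ≤ ‖(T.symm : Y →L[ℝ] X)‖ * ‖T x‖ := fun x => by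
    simpa using (T.symm : Y →L[ℝ] X).le_opNorm (T x)
  rcases (norm_nonneg (T : X →L[ℝ] Y)).eq_or_lt with h0 | h0
  -- If the isomorphism has norm zero, the space is trivial and any map works.
  · refine ⟨0, fun x => ?_⟩
    have h1 := hupper x
    have h2 := hlower x
    rw [← h0, zero_mul] at h1
    rw [h1.antisymm (norm_nonneg _), mul_zero] at h2
    rw [norm_le_zero_iff.1 h2]
    simp
  · refine ⟨(‖(T : X →L[ℝ] Y)‖⁻¹ : ℝ) • (T : X →ₗ[ℝ] Y), fun x => ?_⟩
    have e : ‖((‖(T : X →L[ℝ] Y)‖⁻¹ : ℝ) • (T : X →ₗ[ℝ] Y)) x‖ =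
        ‖(T : X →L[ℝ] Y)‖⁻¹ * ‖T x‖ := by
      simp [norm_smul]
    rw [e]
    constructor
    · rw [inv_mul_le_iff₀ h0]
      exact hupper x
    · calc ‖x‖ ≤ ‖(T.symm : Y →L[ℝ] X)‖ * ‖T x‖ := hlower x
        _ = (‖(T : X →L[ℝ] Y)‖ * ‖(T.symm : Y →L[ℝ] X)‖) * (‖(T : X →L[ℝ] Y)‖⁻¹ * ‖T x‖) := by
          field_simp
        _ ≤ δ * (‖(T : X →L[ℝ] Y)‖⁻¹ * ‖T x‖) := by gcongr

/-- A linear map on a nontrivial finite-dimensional space attains its norm. -/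
theorem LinearMap.exists_norm_eq_one_forall_le {X H : Type*} [NormedAddCommGroup X]
    [NormedSpace ℝ X] [FiniteDimensional ℝ X] [Nontrivial X] [NormedAddCommGroup H]
    [NormedSpace ℝ H] (L : X →ₗ[ℝ] H) :
    ∃ u, ‖u‖ = 1 ∧ ∀ x, ‖L x‖ ≤ ‖L u‖ * ‖x‖ := by
  have := FiniteDimensional.proper ℝ X
  have hL : Continuous L := L.continuous_of_finiteDimensional
  obtain ⟨u, hu, hmax⟩ := (isCompact_sphere (0 : X) 1).exists_isMaxOn
    (NormedSpace.sphere_nonempty.2 zero_le_one) hL.norm.continuousOn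
  refine ⟨u, by simpa using hu, fun x => ?_⟩
  rcases eq_or_ne x 0 with rfl | hx
  · simp
  have hx0 : 0 < ‖x‖ := norm_pos_iff.2 hx
  have := hmax (show ‖x‖⁻¹ • x ∈ Metric.sphere (0 : X) 1 by simp [norm_smul, hx])
  simp only [Set.mem_ofPred_eq, map_smul, norm_smul, norm_inv, norm_norm] at this
  rwa [inv_mul_le_iff₀ hx0, mul_comm] at this

/-- An injective linear map on a nontrivial finite-dimensional space attains the norm of its
inverse. -/
theorem LinearMap.exists_norm_apply_eq_one_forall_le {X H : Type*} [NormedAddCommGroup X]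
    [NormedSpace ℝ X] [FiniteDimensional ℝ X] [Nontrivial X] [NormedAddCommGroup H]
    [NormedSpace ℝ H] {L : X →ₗ[ℝ] H} (hL : Function.Injective L) :
    ∃ v, ‖L v‖ = 1 ∧ ∀ x, ‖x‖ ≤ ‖v‖ * ‖L x‖ := by
  let e : X ≃ₗ[ℝ] L.range := LinearEquiv.ofInjective L hL
  have : Nontrivial L.range := e.symm.toEquiv.nontrivial
  obtain ⟨u, hu, h⟩ := LinearMap.exists_norm_eq_one_forall_le (e.symm : L.range →ₗ[ℝ] X)
  have he : ∀ x, ‖e x‖ = ‖L x‖ := fun x => rfl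
  refine ⟨e.symm u, by rw [← he, e.apply_symm_apply, hu], fun x => ?_⟩
  simpa [he] using h (e x)

end BanachMazur

/-! ### Choice of signs in inner product spaces. -/

section Signs

variable {ι H : Type*} [NormedAddCommGroup H] [InnerProductSpace ℝ H]

theorem exists_sign_inner_nonneg (x y : H) :
    ∃ c : ℝ, |c| = 1 ∧ 0 ≤ inner ℝ x (c • y) := by
  rcases le_total 0 (inner ℝ x y) with h | h
  · exact ⟨1, by simp, by simpa using h⟩
  · exact ⟨-1, by simp, by simpa [inner_neg_right] using h⟩

/-- The average of `‖∑ ε i • w i‖ ^ 2` over all signs is `∑ ‖w i‖ ^ 2`, so some signs reach it. Here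
they are chosen greedily, each new one making the cross term with the previous sum nonnegative. -/
theorem exists_signs_sum_sq_norm_le (s : Finset ι) (w : ι → H) :
    ∃ ε : ι → ℝ, (∀ i, |ε i| = 1) ∧ ∑ i ∈ s, ‖w i‖ ^ 2 ≤ ‖∑ i ∈ s, ε i • w i‖ ^ 2 := by
  classical
  induction s using Finset.induction_on with
  | empty => exact ⟨1, by simp, by simp⟩
  | insert a s ha ih =>
    obtain ⟨ε, hε, h⟩ := ih
    obtain ⟨c, hc, hin⟩ := exists_sign_inner_nonneg (∑ i ∈ s, ε i • w i) (w a)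
    refine ⟨Function.update ε a c, fun i => ?_, ?_⟩
    · rcases eq_or_ne i a with rfl | hi
      · simpa using hc
      · simpa [hi] using hε i
    · have e : ∑ i ∈ s, Function.update ε a c i • w i = ∑ i ∈ s, ε i • w i :=
        Finset.sum_congr rfl fun i hi => by
          rw [Function.update_of_ne (ne_of_mem_of_not_mem hi ha)]
      rw [Finset.sum_insert ha, Finset.sum_insert ha, e, Function.update_self, add_comm (c • w a),
        norm_add_sq_real, norm_smul, Real.norm_eq_abs, hc]
      linarith

theorem exists_signs_norm_sq_le_sum (s : Finset ι) (w : ι → H) :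
    ∃ ε : ι → ℝ, (∀ i, |ε i| = 1) ∧ ‖∑ i ∈ s, ε i • w i‖ ^ 2 ≤ ∑ i ∈ s, ‖w i‖ ^ 2 := by
  classical
  induction s using Finset.induction_on with
  | empty => exact ⟨1, by simp, by simp⟩
  | insert a s ha ih =>
    obtain ⟨ε, hε, h⟩ := ih
    obtain ⟨c, hc, hin⟩ := exists_sign_inner_nonneg (-∑ i ∈ s, ε i • w i) (w a)
    refine ⟨Function.update ε a c, fun i => ?_, ?_⟩
    · rcases eq_or_ne i a with rfl | hi
      · simpa using hc
      · simpa [hi] using hε i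
    · have e : ∑ i ∈ s, Function.update ε a c i • w i = ∑ i ∈ s, ε i • w i :=
        Finset.sum_congr rfl fun i hi => by
          rw [Function.update_of_ne (ne_of_mem_of_not_mem hi ha)]
      rw [inner_neg_left] at hin
      rw [Finset.sum_insert ha, Finset.sum_insert ha, e, Function.update_self, add_comm (c • w a),
        norm_add_sq_real, norm_smul, Real.norm_eq_abs, hc]
      linarith

end Signs

/-! ### The two inequalities for `ℓ_p`-sums. -/

section DirectSum

variable {ι : Type*} {X : ι → Type*} [∀ i, NormedAddCommGroup (X i)]
  [∀ i, NormedSpace ℝ (X i)] {p : ℝ≥0∞}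

/-- The block-diagonal linear map from an `ℓ_p`-sum into a Hilbert sum. -/
def PiLp.diagonalMap (p : ℝ≥0∞) {Y : ι → Type*} [∀ i, NormedAddCommGroup (Y i)]
    [∀ i, NormedSpace ℝ (Y i)] (L : ∀ i, X i →ₗ[ℝ] Y i) : PiLp p X →ₗ[ℝ] PiLp 2 Y :=
  (WithLp.linearEquiv 2 ℝ (∀ i, Y i)).symm.toLinearMap ∘ₗ
    LinearMap.pi (fun i => L i ∘ₗ LinearMap.proj i) ∘ₗ
    (WithLp.linearEquiv p ℝ (∀ i, X i)).toLinearMap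

theorem PiLp.diagonalMap_apply {Y : ι → Type*} [∀ i, NormedAddCommGroup (Y i)]
    [∀ i, NormedSpace ℝ (Y i)] (L : ∀ i, X i →ₗ[ℝ] Y i) (x : PiLp p X) (i : ι) :
    PiLp.diagonalMap p L x i = L i (x i) := rfl

variable [Fintype ι]

theorem finiteDimensional_piLp [∀ i, FiniteDimensional ℝ (X i)] : FiniteDimensional ℝ (PiLp p X) :=
  (WithLp.linearEquiv p ℝ (∀ i, X i)).symm.finiteDimensional

theorem finrank_piLp [∀ i, FiniteDimensional ℝ (X i)] :
    Module.finrank ℝ (PiLp p X) = ∑ i, Module.finrank ℝ (X i) := by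
  rw [(WithLp.linearEquiv p ℝ (∀ i, X i)).finrank_eq, Module.finrank_pi_fintype]

variable [Fact (1 ≤ p)]

theorem PiLp.norm_eq_norm_toLp_norm {α : ι → Type*} [∀ i, NormedAddCommGroup (α i)]
    (x : PiLp p α) : ‖x‖ = ‖WithLp.toLp p fun i => ‖x i‖‖ :=
  PiLp.norm_congr p fun i => by simp

/-- Averaging over signs: a lower and an upper bound of a linear map into an inner product space
pass to the Hilbert sum of its restrictions to the summands. -/
theorem PiLp.norm_le_of_forall_le_norm [DecidableEq ι] {H : Type*} [NormedAddCommGroup H]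
    [InnerProductSpace ℝ H] (T : PiLp p X →ₗ[ℝ] H) {A B : ℝ} (hB : 0 ≤ B)
    (h₁ : ∀ x, ‖T x‖ ≤ A * ‖x‖) (h₂ : ∀ x, ‖x‖ ≤ B * ‖T x‖) (x : PiLp p X) :
    ‖WithLp.toLp 2 fun i => ‖T (PiLp.single p i (x i))‖‖ ≤ A * ‖x‖ ∧
      ‖x‖ ≤ B * ‖WithLp.toLp 2 fun i => ‖T (PiLp.single p i (x i))‖‖ := by
  set w : ι → H := fun i => T (PiLp.single p i (x i)) with hw
  have hsum : ‖WithLp.toLp 2 fun i => ‖w i‖‖ ^ 2 = ∑ i, ‖w i‖ ^ 2 := by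
    simp [PiLp.norm_sq_eq_of_L2]
  have key : ∀ ε : ι → ℝ, (∀ i, |ε i| = 1) →
      ‖∑ i, ε i • w i‖ ≤ A * ‖x‖ ∧ ‖x‖ ≤ B * ‖∑ i, ε i • w i‖ := by
    intro ε hε
    -- Sign changes of the coordinates are isometries of the `ℓ_p`-sum, so the bounds for `T` hold
    -- for every signed sum.
    let y : PiLp p X := WithLp.toLp p fun i => ε i • x i
    have hy : ‖y‖ = ‖x‖ := PiLp.norm_congr p fun i => by
      simp [y, norm_smul, hε]
    have hTy : T y = ∑ i, ε i • w i := by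
      have : y = ∑ i, ε i • PiLp.single p i (x i) := by
        ext j
        simp [y, WithLp.ofLp_sum, Finset.sum_apply, PiLp.ofLp_single, Finset.sum_pi_single,
          ← Pi.single_smul]
      rw [this, map_sum]
      simp [hw]
    rw [← hTy, ← hy]
    exact ⟨h₁ y, h₂ y⟩
  constructor
  · obtain ⟨ε, hε, h⟩ := exists_signs_sum_sq_norm_le Finset.univ w
    rw [← hsum] at h
    exact ((sq_le_sq₀ (norm_nonneg _) (norm_nonneg _)).1 h).trans (key ε hε).1
  · obtain ⟨ε, hε, h⟩ := exists_signs_norm_sq_le_sum Finset.univ w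
    rw [← hsum] at h
    refine (key ε hε).2.trans ?_
    gcongr
    exact (sq_le_sq₀ (norm_nonneg _) (norm_nonneg _)).1 h

variable {n : ι → ℕ} [∀ i, FiniteDimensional ℝ (X i)]

theorem banachMazurDist_piLp_le_of_lt (hX : ∀ i, Module.finrank ℝ (X i) = n i)
    {r : ℝ≥0∞} [Fact (1 ≤ r)]
    (hr : p ≤ 2 ∧ ENNReal.HolderTriple 2 r p ∨ 2 ≤ p ∧ ENNReal.HolderTriple p r 2)
    {δ : ι → ℝ} (hδ : ∀ i, banachMazurDist (X i) (EuclideanSpace ℝ (Fin (n i))) < δ i) :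
    banachMazurDist (PiLp p X) (EuclideanSpace ℝ (Fin (∑ i, n i))) ≤ ‖WithLp.toLp r δ‖ := by
  have := finiteDimensional_piLp (X := X) (p := p)
  have hrank : Module.finrank ℝ (PiLp p X) = ∑ i, n i := by
    rw [finrank_piLp]; exact Finset.sum_congr rfl fun i _ => hX i
  choose L hL using fun i => exists_linearMap_of_banachMazurDist_lt (by simp [hX i]) (hδ i)
  have hδ0 : ∀ i, 0 ≤ δ i := fun i => (banachMazurDist_nonneg _ _).trans (hδ i).le
  rcases hr with ⟨h, hr⟩ | ⟨h, hr⟩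
  -- For `p ≤ 2` the diagonal map is a contraction and its inverse carries the weight `δ`.
  · rw [← one_mul ‖WithLp.toLp r δ‖]
    refine banachMazurDist_euclidean_le hrank (PiLp.diagonalMap p L) zero_le_one (norm_nonneg _)
      (fun x => ?_) fun x => ?_
    · calc ‖PiLp.diagonalMap p L x‖ ≤ ‖WithLp.toLp 2 fun i => ‖x i‖‖ :=
            PiLp.norm_mono 2 fun i => by
              simpa [PiLp.diagonalMap_apply] using (hL i (x i)).1
        _ ≤ ‖WithLp.toLp p fun i => ‖x i‖‖ := PiLp.norm_toLp_le_of_le h _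
        _ = 1 * ‖x‖ := by rw [one_mul, ← PiLp.norm_eq_norm_toLp_norm]
    · calc ‖x‖ ≤ ‖WithLp.toLp p (δ * fun i => ‖L i (x i)‖)‖ :=
            PiLp.norm_mono p fun i => by
              simpa [abs_of_nonneg (hδ0 i)] using (hL i (x i)).2
        _ ≤ ‖WithLp.toLp r δ‖ * ‖WithLp.toLp 2 fun i => ‖L i (x i)‖‖ := PiLp.norm_toLp_mul_le 2 r _ _
        _ = ‖WithLp.toLp r δ‖ * ‖PiLp.diagonalMap p L x‖ := by
          rw [PiLp.norm_eq_norm_toLp_norm (PiLp.diagonalMap p L x)]; rfl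
  -- For `p ≥ 2` each block is rescaled by `δ i`, so that the inverse is a contraction and the map
  -- carries the weight.
  · rw [← mul_one ‖WithLp.toLp r δ‖]
    refine banachMazurDist_euclidean_le hrank (PiLp.diagonalMap p fun i => δ i • L i)
      (norm_nonneg _) zero_le_one (fun x => ?_) fun x => ?_
    · calc ‖PiLp.diagonalMap p (fun i => δ i • L i) x‖
          ≤ ‖WithLp.toLp 2 (δ * fun i => ‖x i‖)‖ :=
            PiLp.norm_mono 2 fun i => by
              simp only [PiLp.diagonalMap_apply, LinearMap.smul_apply, norm_smul, Pi.mul_apply,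
                norm_mul, norm_norm]
              gcongr
              exact (hL i (x i)).1
        _ ≤ ‖WithLp.toLp r δ‖ * ‖WithLp.toLp p fun i => ‖x i‖‖ := PiLp.norm_toLp_mul_le p r _ _
        _ = ‖WithLp.toLp r δ‖ * ‖x‖ := by rw [← PiLp.norm_eq_norm_toLp_norm]
    · calc ‖x‖ = ‖WithLp.toLp p fun i => ‖x i‖‖ := PiLp.norm_eq_norm_toLp_norm x
        _ ≤ ‖WithLp.toLp 2 fun i => ‖x i‖‖ := PiLp.norm_toLp_le_of_le h _
        _ ≤ ‖PiLp.diagonalMap p (fun i => δ i • L i) x‖ :=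
            PiLp.norm_mono 2 fun i => by
              simpa [PiLp.diagonalMap_apply, norm_smul, abs_of_nonneg (hδ0 i)]
                using (hL i (x i)).2
        _ = 1 * _ := (one_mul _).symm

/-- The infima need not be known to be attained: use `d i + ε` as strict upper bounds and let `ε`
tend to `0`. -/
theorem banachMazurDist_piLp_le (hX : ∀ i, Module.finrank ℝ (X i) = n i)
    {r : ℝ≥0∞} [Fact (1 ≤ r)]
    (hr : p ≤ 2 ∧ ENNReal.HolderTriple 2 r p ∨ 2 ≤ p ∧ ENNReal.HolderTriple p r 2) :
    banachMazurDist (PiLp p X) (EuclideanSpace ℝ (Fin (∑ i, n i))) ≤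
      ‖WithLp.toLp r fun i => banachMazurDist (X i) (EuclideanSpace ℝ (Fin (n i)))‖ := by
  set d : ι → ℝ := fun i => banachMazurDist (X i) (EuclideanSpace ℝ (Fin (n i))) with hd
  have hlim : Filter.Tendsto (fun ε : ℝ => ‖WithLp.toLp r d + ε • WithLp.toLp r (1 : ι → ℝ)‖)
      (nhdsWithin 0 (Set.Ioi 0)) (nhds ‖WithLp.toLp r d‖) := by
    have : Continuous fun ε : ℝ => ‖WithLp.toLp r d + ε • WithLp.toLp r (1 : ι → ℝ)‖ := by
      fun_prop
    simpa using (this.tendsto 0).mono_left nhdsWithin_le_nhds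
  refine ge_of_tendsto hlim ?_
  filter_upwards [self_mem_nhdsWithin] with ε hε
  exact banachMazurDist_piLp_le_of_lt hX hr (δ := fun i => d i + ε • (1 : ℝ)) fun i => by
    simpa [hd] using hε

/-- With `S i` the restriction of `T` to a summand, each distance is at most `‖S i‖ * ‖(S i)⁻¹‖`.
One factor is bounded uniformly by `A` or `B`; the other, as a sequence in `i`, is bounded in
`r`-norm by converse Hölder. -/
theorem norm_toLp_banachMazurDist_le [∀ i, Nontrivial (X i)]
    (hX : ∀ i, Module.finrank ℝ (X i) = n i) {r : ℝ≥0∞} [Fact (1 ≤ r)]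
    (hr : p ≤ 2 ∧ ENNReal.HolderTriple 2 r p ∨ 2 ≤ p ∧ ENNReal.HolderTriple p r 2)
    {H : Type*} [NormedAddCommGroup H] [InnerProductSpace ℝ H] (T : PiLp p X →ₗ[ℝ] H) {A B : ℝ}
    (hA : 0 ≤ A) (hB : 0 ≤ B) (h₁ : ∀ x, ‖T x‖ ≤ A * ‖x‖) (h₂ : ∀ x, ‖x‖ ≤ B * ‖T x‖) :
    ‖WithLp.toLp r fun i => banachMazurDist (X i) (EuclideanSpace ℝ (Fin (n i)))‖ ≤ A * B := by
  classical
  set d : ι → ℝ := fun i => banachMazurDist (X i) (EuclideanSpace ℝ (Fin (n i))) with hd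
  have hd0 : ∀ i, 0 ≤ d i := fun i => banachMazurDist_nonneg _ _
  have key := PiLp.norm_le_of_forall_le_norm T hB h₁ h₂
  let S : ∀ i, X i →ₗ[ℝ] H := fun i =>
    T ∘ₗ (WithLp.linearEquiv p ℝ (∀ i, X i)).symm.toLinearMap ∘ₗ LinearMap.single ℝ X i
  have hS₁ : ∀ i x, ‖S i x‖ ≤ A * ‖x‖ := fun i x => by
    have := h₁ (PiLp.single p i x)
    rwa [PiLp.norm_single] at this
  have hS₂ : ∀ i x, ‖x‖ ≤ B * ‖S i x‖ := fun i x => by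
    have := h₂ (PiLp.single p i x)
    rwa [PiLp.norm_single] at this
  have hinj : ∀ i, Function.Injective (S i) := fun i =>
    (injective_iff_map_eq_zero (S i)).2 fun x hx => by
      have := hS₂ i x
      rw [hx, norm_zero, mul_zero] at this
      exact norm_le_zero_iff.1 this
  choose u hu hu' using fun i => LinearMap.exists_norm_eq_one_forall_le (S i)
  choose v hv hv' using fun i => LinearMap.exists_norm_apply_eq_one_forall_le (hinj i)
  have hduv : ∀ i, d i ≤ ‖S i (u i)‖ * ‖v i‖ := fun i =>
    banachMazurDist_euclidean_le (hX i) (S i) (norm_nonneg _) (norm_nonneg _) (hu' i) (hv' i)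
  rcases hr with ⟨h, hr⟩ | ⟨h, hr⟩
  -- Since `‖S i (v i)‖ = 1`, the vector with blocks `g i • v i` has diagonal image of norm `‖g‖` in
  -- `ℓ_2`, so the lower bound on `T` controls multiplication by `‖v i‖` from `ℓ_2` to `ℓ_p`.
  · have hvB : ‖WithLp.toLp r fun i => ‖v i‖‖ ≤ B := by
      refine PiLp.norm_toLp_le_of_forall_mul_le (s := p) 2 r (fun i => norm_nonneg _) hB fun g hg => ?_
      calc ‖WithLp.toLp p ((fun i => ‖v i‖) * g)‖ = ‖(WithLp.toLp p fun i => g i • v i : PiLp p X)‖ :=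
            PiLp.norm_congr p fun i => by simp [norm_smul, mul_comm]
        _ ≤ _ := (key (WithLp.toLp p fun i => g i • v i)).2
        _ = B * ‖WithLp.toLp 2 g‖ := by
          congr 1
          refine PiLp.norm_congr 2 fun i => ?_
          change ‖‖S i (g i • v i)‖‖ = ‖g i‖
          simp [norm_smul, hv]
    calc ‖WithLp.toLp r d‖ ≤ ‖A • WithLp.toLp r fun i => ‖v i‖‖ :=
          PiLp.norm_mono r fun i => by
            have : ‖S i (u i)‖ ≤ A := by simpa [hu] using hS₁ i (u i)
            simpa [abs_of_nonneg (hd0 i), abs_of_nonneg hA] using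
              (hduv i).trans (by gcongr)
      _ ≤ A * B := by
        rw [norm_smul, Real.norm_of_nonneg hA]
        gcongr
  -- Dually, the blocks `g i • u i` with `‖u i‖ = 1` form a vector of norm `‖g‖` in `ℓ_p`, and the
  -- upper bound on `T` controls multiplication by `‖S i (u i)‖` from `ℓ_p` to `ℓ_2`.
  · have huA : ‖WithLp.toLp r fun i => ‖S i (u i)‖‖ ≤ A := by
      refine PiLp.norm_toLp_le_of_forall_mul_le (s := 2) p r (fun i => norm_nonneg _) hA fun g hg => ?_
      calc ‖WithLp.toLp 2 ((fun i => ‖S i (u i)‖) * g)‖ =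
            ‖WithLp.toLp 2 fun i => ‖S i (g i • u i)‖‖ :=
            PiLp.norm_congr 2 fun i => by simp [norm_smul, mul_comm]
        _ ≤ A * ‖(WithLp.toLp p fun i => g i • u i : PiLp p X)‖ :=
            (key (WithLp.toLp p fun i => g i • u i)).1
        _ = A * ‖WithLp.toLp p g‖ := by
          congr 1
          exact PiLp.norm_congr p fun i => by simp [norm_smul, hu]
    calc ‖WithLp.toLp r d‖ ≤ ‖B • WithLp.toLp r fun i => ‖S i (u i)‖‖ :=
          PiLp.norm_mono r fun i => by
            have : ‖v i‖ ≤ B := by simpa [hv] using hS₂ i (v i)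
            simpa [abs_of_nonneg (hd0 i), abs_of_nonneg hB, mul_comm B] using
              (hduv i).trans (by gcongr)
      _ ≤ A * B := by
        rw [norm_smul, Real.norm_of_nonneg hB, mul_comm]
        gcongr

end DirectSum

theorem theorem1p1 {k : ℕ} (n : Fin k → ℕ) (hn : ∀ i, 1 ≤ n i)
    (X : Fin k → Type*) [∀ i, NormedAddCommGroup (X i)] [∀ i, NormedSpace ℝ (X i)]
    (hX : ∀ i, Module.finrank ℝ (X i) = n i)
    (p : ℝ≥0∞) [Fact (1 ≤ p)] :
    2 ≤ sumExponent p ∧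
      banachMazurDist (PiLp p X) (EuclideanSpace ℝ (Fin (∑ i, n i))) =
        ‖WithLp.toLp (sumExponent p)
          (fun i => banachMazurDist (X i) (EuclideanSpace ℝ (Fin (n i))))‖ := by
  have hp : 1 ≤ p := Fact.out
  have h2 := two_le_sumExponent hp
  refine ⟨h2, ?_⟩
  have : Fact (1 ≤ sumExponent p) := ⟨one_le_two.trans h2⟩
  -- As `finrank` is `0` on infinite-dimensional spaces, its positivity yields finite dimension as
  -- well as nontriviality.
  have hpos : ∀ i, 0 < Module.finrank ℝ (X i) := fun i => by rw [hX i]; exact hn i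
  have : ∀ i, FiniteDimensional ℝ (X i) := fun i => Module.finite_of_finrank_pos (hpos i)
  have : ∀ i, Nontrivial (X i) := fun i => Module.nontrivial_of_finrank_pos (hpos i)
  have hr : p ≤ 2 ∧ ENNReal.HolderTriple 2 (sumExponent p) p ∨
      2 ≤ p ∧ ENNReal.HolderTriple p (sumExponent p) 2 :=
    (le_total p 2).imp (fun h => ⟨h, holderTriple_sumExponent_of_le_two hp h⟩)
      fun h => ⟨h, holderTriple_sumExponent_of_two_le h⟩
  refine (banachMazurDist_piLp_le hX hr).antisymm ?_
  have := finiteDimensional_piLp (X := X) (p := p)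
  -- An infimum over an empty family of reals would be `0`, so an isomorphism must exist before
  -- bounding it from below.
  have : Nonempty (PiLp p X ≃L[ℝ] EuclideanSpace ℝ (Fin (∑ i, n i))) :=
    FiniteDimensional.nonempty_continuousLinearEquiv_of_finrank_eq (by simp [finrank_piLp, hX])
  refine le_ciInf fun T => ?_
  let T' : PiLp p X →L[ℝ] EuclideanSpace ℝ (Fin (∑ i, n i)) := T
  refine norm_toLp_banachMazurDist_le hX hr T'.toLinearMap (norm_nonneg _) (norm_nonneg _)
    T'.le_opNorm fun x => ?_
  simpa [T'] using (T.symm : _ →L[ℝ] PiLp p X).le_opNorm (T x)
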